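/- Let $d \ge 1$ and $r$ be integers with $r > d/2$. Let $W_2^r = W_2^r(\mathbb{R}^d)$ be the Sobolev space of all real $f \in L_2(\mathbb{R}^d)$ whose weak derivatives $D^\alpha f$ exist and lie in $L_2(\mathbb{R}^d)$ for all multi-indices $|\alpha| \le r$, with norm $\|f\|_{W_2^r} = \big(\sum_{|\alpha| \le r} \|D^\alpha f\|_{L_2}^2\big)^{1/2}$. Since $r > d/2$, its elements are identified with their continuous representatives, which makes it a reproducing kernel Hilbert space. Let $C_0^s = C_0^s(\mathbb{R}^d)$ be the set of all functions on $\mathbb{R}^d$ that are $s$ times continuously differentiable, vanish at infinity, and have bounded derivatives up to order $s$. Let $P$ be a Borel probability measure on $\mathbb{R}^d$. For each $n$ let $w_1^{(n)},\dots,w_n^{(n)} \in \mathbb{R}$ and $X_1^{(n)},\dots,X_n^{(n)} \in \mathbb{R}^d$ be (deterministic) weights and points, and write $Pf = \int f\,dP$, $P_n f = \sum_{i=1}^n w_i^{(n)} f(X_i^{(n)})$ and $$e_n(P; W_2^r) = \sup_{f \in W_2^r,\ \|f\|_{W_2^r} \le 1} |Pf - P_n f| .$$ (i) Suppose that $e_n(P;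 W_2^r) = O(n^{-b})$ for some $b > 0$ and $\sum_{i=1}^n (w_i^{(n)})^2 = O(n^{-2c})$ for some $0 < c \le 1/2$, as $n \to \infty$. Then for every integer $0 \le s \le r$ and every $f \in C_0^s \cap W_2^s$, $$|P_n f - P f| = O\big(n^{-bs/r + (1/2 - c)(1 - s/r)}\big) \qquad (n \to \infty).$$ (ii) In particular, if $e_n(P; W_2^r) = O(n^{-r/d})$ (the optimal rate in $W_2^r$) and $\sum_{i=1}^n (w_i^{(n)})^2 = O(n^{-1})$, then for every integer $0 \le s \le r$ and every $f \in C_0^s \cap W_2^s$ we have $|P_n f - P f| = O(n^{-s/d})$ (the optimal rate in $W_2^s$). -/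

import Mathlib

open MeasureTheory Filter Topology
open scoped ENNReal NNReal ContDiff

noncomputable section

/-- Classical partial derivative `∂ᵢ φ` of a function on `ℝ^d`. -/
def partialDeriv {d : ℕ} (i : Fin d) (φ : EuclideanSpace ℝ (Fin d) → ℝ) :
    EuclideanSpace ℝ (Fin d) → ℝ :=
  fun x => fderiv ℝ φ x (EuclideanSpace.single i 1)

/-- Order `|α| = ∑ᵢ αᵢ` of a multi-index. -/
def multiOrder {d : ℕ} (α : Fin d → ℕ) : ℕ := ∑ i, α i

/-- Classical mixed partial derivative `D^α φ = ∂₀^{α₀} ⋯ ∂_{d-1}^{α_{d-1}} φ`. It is only applied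
to smooth functions, for which the order of differentiation is irrelevant. -/
def mixedPartial {d : ℕ} (α : Fin d → ℕ) (φ : EuclideanSpace ℝ (Fin d) → ℝ) :
    EuclideanSpace ℝ (Fin d) → ℝ :=
  (List.finRange d).foldr (fun i ψ => (partialDeriv i)^[α i] ψ) φ

/-- `g` is an `α`-th weak derivative of `f` on `ℝ^d`:
`∫ f D^α φ = (-1)^{|α|} ∫ g φ` for every test function `φ ∈ C_c^∞(ℝ^d)`. -/
def IsWeakDeriv {d : ℕ} (α : Fin d → ℕ) (f g : EuclideanSpace ℝ (Fin d) → ℝ) : Prop :=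
  LocallyIntegrable f volume ∧ LocallyIntegrable g volume ∧
    ∀ φ : EuclideanSpace ℝ (Fin d) → ℝ, ContDiff ℝ ∞ φ → HasCompactSupport φ →
      ∫ x, f x * mixedPartial α φ x = (-1) ^ multiOrder α * ∫ x, g x * φ x

open Classical in
/-- The weak derivative `D^α f` (unique up to null sets), and `0` if there is none. -/
def weakDeriv {d : ℕ} (α : Fin d → ℕ) (f : EuclideanSpace ℝ (Fin d) → ℝ) :
    EuclideanSpace ℝ (Fin d) → ℝ :=
  if h : ∃ g, IsWeakDeriv α f g then h.choose else 0

/-- `f ∈ W_2^r(ℝ^d)`: `f ∈ L_2`, and the weak derivative `D^α f` exists and lies in `L_2` for all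
`|α| ≤ r`. -/
def MemSobolev {d : ℕ} (r : ℕ) (f : EuclideanSpace ℝ (Fin d) → ℝ) : Prop :=
  MemLp f 2 volume ∧
    ∀ α : Fin d → ℕ, multiOrder α ≤ r → ∃ g, IsWeakDeriv α f g ∧ MemLp g 2 volume

/-- The Sobolev norm `‖f‖_{W_2^r} = (∑_{|α| ≤ r} ‖D^α f‖_{L_2}^2)^{1/2}`; the multi-indices are
listed by their order `k ≤ r`. -/
def sobolevNorm {d : ℕ} (r : ℕ) (f : EuclideanSpace ℝ (Fin d) → ℝ) : ℝ :=
  √(∑ k ∈ Finset.range (r + 1), ∑ α ∈ Finset.piAntidiag (Finset.univ : Finset (Fin d)) k,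
    (eLpNorm (weakDeriv α f) 2 volume).toReal ^ 2)

/-- The closed unit ball of `W_2^r(ℝ^d)` viewed as a space of functions. For `r > d/2` every class
in `W_2^r` has exactly one continuous representative, and this is the function that the
reproducing kernel Hilbert space `W_2^r` contains. -/
def sobolevUnitBall (d r : ℕ) : Set (EuclideanSpace ℝ (Fin d) → ℝ) :=
  {f | Continuous f ∧ MemSobolev r f ∧ sobolevNorm r f ≤ 1}

/-- The quadrature value `P_n f = ∑ᵢ wᵢ f(Xᵢ)`. -/
def quadrature {d n : ℕ} (w : Fin n → ℝ) (X : Fin n → EuclideanSpace ℝ (Fin d))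
    (f : EuclideanSpace ℝ (Fin d) → ℝ) : ℝ :=
  ∑ i, w i * f (X i)

/-- The worst case error `e_n(P; W_2^r) = sup {|P f - P_n f| : f ∈ W_2^r, ‖f‖_{W_2^r} ≤ 1}`, as an
extended nonnegative number so that the supremum is a genuine one. -/
def worstCaseError {d n : ℕ} (r : ℕ) (P : Measure (EuclideanSpace ℝ (Fin d)))
    (w : Fin n → ℝ) (X : Fin n → EuclideanSpace ℝ (Fin d)) : ℝ≥0∞ :=
  ⨆ f ∈ sobolevUnitBall d r, ENNReal.ofReal |(∫ x, f x ∂P) - quadrature w X f|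

/-- `e_n = O(n^{-b})` as `n → ∞`, for a sequence of extended nonnegative numbers. -/
def HasRate (e : ℕ → ℝ≥0∞) (b : ℝ) : Prop :=
  ∃ C : ℝ, ∀ᶠ n : ℕ in atTop, e n ≤ ENNReal.ofReal (C * (n : ℝ) ^ (-b))

/-- `f ∈ C_0^s(ℝ^d)`: `f` is `s` times continuously differentiable, vanishes at infinity, and has
finite `C_0^s` norm, that is, its derivatives up to order `s` are bounded. -/
def MemC0 {d : ℕ} (s : ℕ) (f : EuclideanSpace ℝ (Fin d) → ℝ) : Prop :=
  ContDiff ℝ s f ∧ Tendsto f (cocompact (EuclideanSpace ℝ (Fin d))) (𝓝 0) ∧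
    ∀ k ≤ s, ∃ C : ℝ, ∀ x, ‖iteratedFDeriv ℝ k f x‖ ≤ C

end

/-! The quadrature is only controlled on `W_2^r`, so the rougher `f` is replaced by a smooth `F = f
⋆ K_σ` and the scale `σ` is optimised. The kernel `K` combines dilates of a bump so that `f - f ⋆
K_σ` is an average of `s`-th differences of `f` with steps of length at most `σ`; hence `|f - F| ≤ C
σ^s` uniformly (`abs_sub_realConv_le`). In a derivative of order at most `r`, up to `s` derivatives
fall weakly on `f` and the other `r - s` on `K_σ`, so Young's inequality bounds its `L_2` norm by a
multiple of `σ^{-(r-s)}` (`exists_smooth_approximation`).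

The error is then at most `e_n ‖F‖_{W_2^r} + (1 + ∑ |w_i|) sup |f - F|`, and Cauchy–Schwarz gives `∑
|w_i| = O(n^{1/2-c})`. Up to constants this is `n^{-b} σ^{-(r-s)} + n^{1/2-c} σ^s`; the choice `σ =
n^{-(b+1/2-c)/r}` makes both terms equal to the claimed rate. -/

noncomputable section

/-! ### Mixed partial derivatives and multi-indices -/

section Partial

variable {d : ℕ} {φ : EuclideanSpace ℝ (Fin d) → ℝ}

theorem ContDiff.partialDeriv (i : Fin d) (h : ContDiff ℝ ∞ φ) :
    ContDiff ℝ ∞ (partialDeriv i φ) :=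
  (h.fderiv_right (m := ∞) le_rfl).clm_apply contDiff_const

theorem HasCompactSupport.partialDeriv (i : Fin d) (h : HasCompactSupport φ) :
    HasCompactSupport (partialDeriv i φ) :=
  h.fderiv_apply ℝ _

theorem partialDeriv_comm (i j : Fin d) (h : ContDiff ℝ ∞ φ) :
    partialDeriv i (partialDeriv j φ) = partialDeriv j (partialDeriv i φ) := by
  have key : ∀ (k l : Fin d) x, partialDeriv k (partialDeriv l φ) x =
      fderiv ℝ (fderiv ℝ φ) x (EuclideanSpace.single k 1) (EuclideanSpace.single l 1) := by
    intro k l x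
    have hd : DifferentiableAt ℝ (fderiv ℝ φ) x :=
      (h.fderiv_right (m := ∞) le_rfl).differentiable (by simp) x
    unfold partialDeriv
    rw [fderiv_clm_apply hd (differentiableAt_const _)]
    simp
  funext x
  rw [key, key]
  exact ((contDiff_infty.1 h 2).contDiffAt.isSymmSndFDerivAt (by simp)) _ _

theorem ContDiff.partialDeriv_iterate (i : Fin d) (n : ℕ) (h : ContDiff ℝ ∞ φ) :
    ContDiff ℝ ∞ ((_root_.partialDeriv i)^[n] φ) := by
  induction n with
  | zero => exact h
  | succ n ih => rw [Function.iterate_succ_apply']; exact ih.partialDeriv i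

theorem partialDeriv_iterate_comm (i j : Fin d) (n : ℕ) (h : ContDiff ℝ ∞ φ) :
    partialDeriv i ((partialDeriv j)^[n] φ) = (partialDeriv j)^[n] (partialDeriv i φ) := by
  induction n with
  | zero => rfl
  | succ n ih =>
    rw [Function.iterate_succ_apply', Function.iterate_succ_apply',
      partialDeriv_comm i j (h.partialDeriv_iterate j n), ih]

theorem contDiff_foldr_partialDeriv (l : List (Fin d)) (α : Fin d → ℕ) (h : ContDiff ℝ ∞ φ) :
    ContDiff ℝ ∞ (l.foldr (fun i ψ => (partialDeriv i)^[α i] ψ) φ) := by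
  induction l with
  | nil => exact h
  | cons a l ih => exact ih.partialDeriv_iterate a (α a)

theorem foldr_partialDeriv_add_single (l : List (Fin d)) (hl : l.Nodup) (α : Fin d → ℕ)
    (i : Fin d) (h : ContDiff ℝ ∞ φ) :
    l.foldr (fun j ψ => (partialDeriv j)^[(α + Pi.single i 1 : Fin d → ℕ) j] ψ) φ =
      if i ∈ l then partialDeriv i (l.foldr (fun j ψ => (partialDeriv j)^[α j] ψ) φ)
      else l.foldr (fun j ψ => (partialDeriv j)^[α j] ψ) φ := by
  induction l with
  | nil => simp
  | cons a l ih =>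
    obtain ⟨ha, hl⟩ := List.nodup_cons.1 hl
    simp only [List.foldr_cons, ih hl]
    by_cases hia : i = a
    · subst hia
      simp [ha, Function.iterate_succ_apply']
    · have hai : a ≠ i := fun e => hia e.symm
      by_cases hil : i ∈ l
      · simp [hil, hai, partialDeriv_iterate_comm i a _ (contDiff_foldr_partialDeriv l α h)]
      · simp [hil, hia, hai]

theorem foldr_partialDeriv_comm (l : List (Fin d)) (α : Fin d → ℕ) (i : Fin d)
    (h : ContDiff ℝ ∞ φ) :
    l.foldr (fun j ψ => (partialDeriv j)^[α j] ψ) (partialDeriv i φ) =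
      partialDeriv i (l.foldr (fun j ψ => (partialDeriv j)^[α j] ψ) φ) := by
  induction l with
  | nil => rfl
  | cons a l ih =>
    simp only [List.foldr_cons, ih,
      partialDeriv_iterate_comm i a _ (contDiff_foldr_partialDeriv l α h)]

theorem ContDiff.mixedPartial (α : Fin d → ℕ) (h : ContDiff ℝ ∞ φ) :
    ContDiff ℝ ∞ (mixedPartial α φ) :=
  contDiff_foldr_partialDeriv _ α h

theorem mixedPartial_zero : mixedPartial (0 : Fin d → ℕ) φ = φ := by
  unfold mixedPartial
  induction List.finRange d with
  | nil => rfl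
  | cons a l ih => simp

theorem mixedPartial_add_single (α : Fin d → ℕ) (i : Fin d) (h : ContDiff ℝ ∞ φ) :
    mixedPartial (α + Pi.single i 1) φ = partialDeriv i (mixedPartial α φ) := by
  unfold mixedPartial
  rw [foldr_partialDeriv_add_single _ (List.nodup_finRange d) α i h]
  simp

theorem mixedPartial_partialDeriv (α : Fin d → ℕ) (i : Fin d) (h : ContDiff ℝ ∞ φ) :
    mixedPartial α (partialDeriv i φ) = partialDeriv i (mixedPartial α φ) :=
  foldr_partialDeriv_comm _ α i h

theorem multiOrder_zero : multiOrder (0 : Fin d → ℕ) = 0 := by simp [multiOrder]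

theorem multiOrder_add_single (α : Fin d → ℕ) (i : Fin d) :
    multiOrder (α + Pi.single i 1) = multiOrder α + 1 := by
  simp [multiOrder, Finset.sum_add_distrib]

theorem multiIndex_induction {p : (Fin d → ℕ) → Prop} (zero : p 0)
    (add_single : ∀ α i, p α → p (α + Pi.single i 1)) (α : Fin d → ℕ) : p α := by
  induction hn : multiOrder α generalizing α with
  | zero =>
    have : α = 0 := by
      funext i
      exact (Finset.sum_eq_zero_iff.1 hn) i (Finset.mem_univ i)
    exact this ▸ zero
  | succ n ih =>
    obtain ⟨i, hi⟩ : ∃ i, α i ≠ 0 := by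
      by_contra! hc
      simp [multiOrder, hc] at hn
    have hα : α - Pi.single i 1 + Pi.single i 1 = α := by
      funext j
      by_cases hj : j = i
      · subst hj; simp; omega
      · simp [hj]
    have ho := multiOrder_add_single (α - Pi.single i 1) i
    rw [hα] at ho
    exact hα ▸ add_single _ i (ih _ (by omega))

theorem HasCompactSupport.mixedPartial (α : Fin d → ℕ) (h : ContDiff ℝ ∞ φ)
    (hc : HasCompactSupport φ) : HasCompactSupport (mixedPartial α φ) := by
  induction α using multiIndex_induction with
  | zero => rwa [mixedPartial_zero]
  | add_single α i ih => rw [mixedPartial_add_single α i h]; exact ih.partialDeriv i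

theorem mixedPartial_add (β γ : Fin d → ℕ) (h : ContDiff ℝ ∞ φ) :
    mixedPartial (β + γ) φ = mixedPartial β (mixedPartial γ φ) := by
  induction β using multiIndex_induction with
  | zero => rw [zero_add, mixedPartial_zero]
  | add_single β i ih =>
    rw [add_right_comm, mixedPartial_add_single _ i h, ih,
      mixedPartial_add_single β i (h.mixedPartial γ)]

/-- Used to share out a derivative: `β` will fall on `f`, `γ` on the kernel, and only `γ` costs
powers of `σ⁻¹`. -/
theorem exists_multiIndex_add (s m : ℕ) (α : Fin d → ℕ) (hα : multiOrder α ≤ s + m) :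
    ∃ β γ : Fin d → ℕ, α = β + γ ∧ multiOrder β ≤ s ∧ multiOrder γ ≤ m := by
  induction α using multiIndex_induction generalizing m with
  | zero => exact ⟨0, 0, by simp, by simp [multiOrder_zero], by simp [multiOrder_zero]⟩
  | add_single α i ih =>
    rw [multiOrder_add_single] at hα
    cases m with
    | zero => exact ⟨_, 0, (add_zero _).symm, by rwa [multiOrder_add_single], by simp [multiOrder]⟩
    | succ m =>
      obtain ⟨β, γ, rfl, hβ, hγ⟩ := ih m (by omega)
      exact ⟨β, γ + Pi.single i 1, by rw [add_assoc], hβ, by rw [multiOrder_add_single]; omega⟩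

theorem partialDeriv_comp_affine (i : Fin d) (h : ContDiff ℝ ∞ φ) (a c : ℝ)
    (v : EuclideanSpace ℝ (Fin d)) :
    partialDeriv i (fun x => c * φ (v + a • x)) = fun x => a * (c * partialDeriv i φ (v + a • x)) := by
  funext x
  have h1 : HasFDerivAt (fun x : EuclideanSpace ℝ (Fin d) => v + a • x)
      (a • ContinuousLinearMap.id ℝ (EuclideanSpace ℝ (Fin d))) x :=
    ((hasFDerivAt_id x).const_smul a).const_add v
  have h2 := (((h.differentiable (by simp) (v + a • x)).hasFDerivAt).comp x h1).const_mul c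
  have h3 : fderiv ℝ (fun x => c * φ (v + a • x)) x = _ := h2.fderiv
  simp only [partialDeriv, h3]
  simp
  ring

theorem contDiff_comp_affine (h : ContDiff ℝ ∞ φ) (a c : ℝ) (v : EuclideanSpace ℝ (Fin d)) :
    ContDiff ℝ ∞ (fun x => c * φ (v + a • x)) := by fun_prop

theorem mixedPartial_comp_affine (α : Fin d → ℕ) (h : ContDiff ℝ ∞ φ) (a c : ℝ)
    (v : EuclideanSpace ℝ (Fin d)) :
    mixedPartial α (fun x => c * φ (v + a • x)) =
      fun x => a ^ multiOrder α * (c * mixedPartial α φ (v + a • x)) := by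
  induction α using multiIndex_induction with
  | zero => simp [mixedPartial_zero, multiOrder_zero]
  | add_single α i ih =>
    rw [mixedPartial_add_single _ i (contDiff_comp_affine h a c v), ih, multiOrder_add_single,
      mixedPartial_add_single _ i h]
    simp only [← mul_assoc]
    rw [partialDeriv_comp_affine i (h.mixedPartial α)]
    funext x
    ring

end Partial

/-! ### Weak derivatives, convolution and Young's inequality -/

section WeakDeriv

variable {d : ℕ} {f g F K : EuclideanSpace ℝ (Fin d) → ℝ}

/-- By the fundamental lemma of the calculus of variations, the representative picked by `weakDeriv`
does not affect the Sobolev norm. -/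
theorem IsWeakDeriv.weakDeriv_ae_eq {α : Fin d → ℕ} (h : IsWeakDeriv α f g) :
    weakDeriv α f =ᵐ[volume] g := by
  have hex : ∃ g, IsWeakDeriv α f g := ⟨g, h⟩
  have hw : weakDeriv α f = hex.choose := by simp only [weakDeriv, dif_pos hex]
  rw [hw]
  refine ae_eq_of_integral_contDiff_smul_eq hex.choose_spec.2.1 h.2.1 fun φ hφ hc => ?_
  have h1 := hex.choose_spec.2.2 φ hφ hc
  rw [h.2.2 φ hφ hc] at h1
  have h2 := mul_left_cancel₀ (pow_ne_zero _ (by norm_num : (-1 : ℝ) ≠ 0)) h1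
  simp only [smul_eq_mul, mul_comm (φ _)]
  exact h2.symm

theorem IsWeakDeriv.const_mul {α : Fin d → ℕ} (h : IsWeakDeriv α f g) (c : ℝ) :
    IsWeakDeriv α (fun x => c * f x) (fun x => c * g x) := by
  refine ⟨h.1.smul c, h.2.1.smul c, fun φ hφ hc => ?_⟩
  simp only [mul_assoc, integral_const_mul, h.2.2 φ hφ hc]
  ring

theorem integral_mul_partialDeriv {φ : EuclideanSpace ℝ (Fin d) → ℝ} (hF : ContDiff ℝ ∞ F)
    (hφ : ContDiff ℝ ∞ φ) (hc : HasCompactSupport φ) (i : Fin d) :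
    ∫ x, F x * partialDeriv i φ x = - ∫ x, partialDeriv i F x * φ x := by
  refine integral_mul_fderiv_eq_neg_fderiv_mul_of_integrable ?_ ?_ ?_
    (fun x _ => hF.differentiable (by simp) x) (fun x _ => hφ.differentiable (by simp) x)
  · exact ((hF.partialDeriv i).continuous.mul hφ.continuous).integrable_of_hasCompactSupport
      hc.mul_left
  · exact (hF.continuous.mul (hφ.partialDeriv i).continuous).integrable_of_hasCompactSupport
      (hc.partialDeriv i).mul_left
  · exact (hF.continuous.mul hφ.continuous).integrable_of_hasCompactSupport hc.mul_left

theorem isWeakDeriv_mixedPartial (hF : ContDiff ℝ ∞ F) (α : Fin d → ℕ) :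
    IsWeakDeriv α F (mixedPartial α F) := by
  refine ⟨hF.continuous.locallyIntegrable, (hF.mixedPartial α).continuous.locallyIntegrable,
    fun φ hφ hc => ?_⟩
  induction α using multiIndex_induction generalizing φ with
  | zero => simp [mixedPartial_zero, multiOrder_zero]
  | add_single α i ih =>
    rw [mixedPartial_add_single α i hφ, mixedPartial_add_single α i hF,
      ← mixedPartial_partialDeriv α i hφ, ih _ (hφ.partialDeriv i) (hc.partialDeriv i),
      integral_mul_partialDeriv (hF.mixedPartial α) hφ hc, multiOrder_add_single]
    ring

/-- The convolution `f ⋆ K` of two real functions on `ℝ^d`. -/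
def realConv (f K : EuclideanSpace ℝ (Fin d) → ℝ) : EuclideanSpace ℝ (Fin d) → ℝ :=
  fun x => ∫ y, f y * K (x - y)

theorem realConv_eq_convolution (f K : EuclideanSpace ℝ (Fin d) → ℝ) :
    realConv f K = convolution f K (ContinuousLinearMap.mul ℝ ℝ) volume := rfl

theorem contDiff_realConv (hf : LocallyIntegrable f volume) (hK : ContDiff ℝ ∞ K)
    (hc : HasCompactSupport K) : ContDiff ℝ ∞ (realConv f K) :=
  hc.contDiff_convolution_right (ContinuousLinearMap.mul ℝ ℝ) hf hK

theorem partialDeriv_realConv (hf : LocallyIntegrable f volume) (hK : ContDiff ℝ ∞ K)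
    (hc : HasCompactSupport K) (i : Fin d) :
    partialDeriv i (realConv f K) = realConv f (partialDeriv i K) := by
  funext x
  have hK1 : ContDiff ℝ 1 K := contDiff_infty.1 hK 1
  have h := (hc.hasFDerivAt_convolution_right (ContinuousLinearMap.mul ℝ ℝ) hf hK1 x).fderiv
  rw [partialDeriv, realConv_eq_convolution, h,
    convolution_precompR_apply _ hf (hc.fderiv ℝ) (hK1.continuous_fderiv (by simp))]
  rfl

theorem mixedPartial_realConv (hf : LocallyIntegrable f volume) (hK : ContDiff ℝ ∞ K)
    (hc : HasCompactSupport K) (α : Fin d → ℕ) :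
    mixedPartial α (realConv f K) = realConv f (mixedPartial α K) := by
  induction α using multiIndex_induction with
  | zero => simp only [mixedPartial_zero]
  | add_single α i ih =>
    rw [mixedPartial_add_single α i (contDiff_realConv hf hK hc), ih,
      mixedPartial_add_single α i hK,
      partialDeriv_realConv hf (hK.mixedPartial α) (hc.mixedPartial α hK)]

/-- The test function is `y ↦ K (x - y)`; the sign from the chain rule cancels the one in the
definition of the weak derivative. -/
theorem IsWeakDeriv.realConv_mixedPartial {β : Fin d → ℕ} (h : IsWeakDeriv β f g)
    (hK : ContDiff ℝ ∞ K) (hc : HasCompactSupport K) :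
    realConv f (mixedPartial β K) = realConv g K := by
  funext x
  have hφ := contDiff_comp_affine hK (-1) 1 x
  have hφc : HasCompactSupport (fun y => 1 * K (x + (-1 : ℝ) • y)) := by
    have := hc.comp_homeomorph (Homeomorph.subLeft x)
    simpa [Function.comp_def, sub_eq_add_neg] using this
  have h1 := h.2.2 _ hφ hφc
  rw [mixedPartial_comp_affine β hK] at h1
  simp only [one_mul, neg_smul, one_smul, ← sub_eq_add_neg, mul_left_comm (f _),
    integral_const_mul] at h1
  exact mul_left_cancel₀ (pow_ne_zero _ (by norm_num : (-1 : ℝ) ≠ 0)) h1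

theorem IsWeakDeriv.mixedPartial_realConv_add {β : Fin d → ℕ} (h : IsWeakDeriv β f g)
    (hK : ContDiff ℝ ∞ K) (hc : HasCompactSupport K) (γ : Fin d → ℕ) :
    mixedPartial (β + γ) (realConv f K) = realConv g (mixedPartial γ K) := by
  rw [mixedPartial_realConv h.1 hK hc, mixedPartial_add β γ hK,
    h.realConv_mixedPartial (hK.mixedPartial γ) (hc.mixedPartial γ hK)]

/-- Cauchy–Schwarz after splitting `|g| |K|` as `(|g|² |K|)^{1/2} |K|^{1/2}`. -/
theorem enorm_realConv_sq_le (hg : AEStronglyMeasurable g volume) (hK : Continuous K)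
    (x : EuclideanSpace ℝ (Fin d)) :
    ‖realConv g K x‖ₑ ^ 2 ≤ (∫⁻ y, ‖K y‖ₑ) * ∫⁻ y, ‖g y‖ₑ ^ 2 * ‖K (x - y)‖ₑ := by
  have hKm : AEMeasurable (fun y => ‖K (x - y)‖ₑ) volume :=
    (hK.comp (continuous_const.sub continuous_id)).enorm.measurable.aemeasurable
  have hhalf : ∀ t : ℝ≥0∞, (t ^ 2) ^ (1 / 2 : ℝ) = t := fun t => by
    rw [← ENNReal.rpow_natCast, ← ENNReal.rpow_mul]; simp
  have hhalf' : ∀ t : ℝ≥0∞, (t ^ (1 / 2 : ℝ)) ^ 2 = t := fun t => by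
    rw [← ENNReal.rpow_natCast, ← ENNReal.rpow_mul]; simp
  have h1 : ‖realConv g K x‖ₑ ≤ ∫⁻ y, ‖g y‖ₑ * ‖K (x - y)‖ₑ := by
    refine (enorm_integral_le_lintegral_enorm _).trans_eq ?_
    simp [enorm_mul]
  have h2 := ENNReal.lintegral_mul_norm_pow_le (μ := volume) (p := 1 / 2) (q := 1 / 2)
    ((hg.enorm.pow_const 2).mul hKm) hKm (by norm_num) (by norm_num) (by norm_num)
  have h3 : ∀ y, (((fun y => ‖g y‖ₑ ^ 2) * fun y => ‖K (x - y)‖ₑ) y) ^ (1 / 2 : ℝ) *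
      ‖K (x - y)‖ₑ ^ (1 / 2 : ℝ) = ‖g y‖ₑ * ‖K (x - y)‖ₑ := fun y => by
    rw [Pi.mul_apply, ENNReal.mul_rpow_of_nonneg _ _ (by norm_num), hhalf, mul_assoc,
      ← ENNReal.mul_rpow_of_nonneg _ _ (by norm_num), ← sq, hhalf]
  simp only [h3] at h2
  have h4 : ∫⁻ y, ‖K (x - y)‖ₑ = ∫⁻ y, ‖K y‖ₑ :=
    lintegral_sub_left_eq_self (fun y => ‖K y‖ₑ) x
  calc ‖realConv g K x‖ₑ ^ 2 ≤ _ := pow_le_pow_left' (h1.trans h2) 2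
    _ = _ := by rw [mul_pow, hhalf', hhalf', h4, mul_comm]; rfl

/-- Young's inequality `L_2 ⋆ L_1 ⊆ L_2`: the pointwise bound is integrated in `x` and Tonelli swaps
the integrals. -/
theorem eLpNorm_two_realConv_le (hg : AEStronglyMeasurable g volume) (hK : Continuous K) :
    eLpNorm (realConv g K) 2 volume ≤ (∫⁻ y, ‖K y‖ₑ) * eLpNorm g 2 volume := by
  have hsq : ∀ u : EuclideanSpace ℝ (Fin d) → ℝ, eLpNorm u 2 volume ^ 2 = ∫⁻ x, ‖u x‖ₑ ^ 2 := by
    intro u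
    have := eLpNorm_nnreal_pow_eq_lintegral (f := u) (μ := volume) (p := 2) (by norm_num)
    simpa using this
  have hm : AEMeasurable (fun p : EuclideanSpace ℝ (Fin d) × EuclideanSpace ℝ (Fin d) =>
      ‖g p.2‖ₑ ^ 2 * ‖K (p.1 - p.2)‖ₑ) (volume.prod volume) :=
    (hg.comp_snd.enorm.pow_const 2).mul
      (hK.comp (continuous_fst.sub continuous_snd)).enorm.measurable.aemeasurable
  refine (ENNReal.pow_le_pow_left_iff two_ne_zero).1 ?_
  rw [mul_pow, hsq, hsq]
  calc ∫⁻ x, ‖realConv g K x‖ₑ ^ 2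
      ≤ ∫⁻ x, (∫⁻ y, ‖K y‖ₑ) * ∫⁻ y, ‖g y‖ₑ ^ 2 * ‖K (x - y)‖ₑ :=
        lintegral_mono fun x => enorm_realConv_sq_le hg hK x
    _ = (∫⁻ y, ‖K y‖ₑ) * ∫⁻ x, ∫⁻ y, ‖g y‖ₑ ^ 2 * ‖K (x - y)‖ₑ :=
        lintegral_const_mul'' _ hm.lintegral_prod_right'
    _ = (∫⁻ y, ‖K y‖ₑ) * ∫⁻ y, ∫⁻ x, ‖g y‖ₑ ^ 2 * ‖K (x - y)‖ₑ := by
        rw [lintegral_lintegral_swap hm]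
    _ = (∫⁻ y, ‖K y‖ₑ) * ∫⁻ y, ‖g y‖ₑ ^ 2 * ∫⁻ x, ‖K x‖ₑ := by
        congr 1
        refine lintegral_congr fun y => ?_
        have hKy : Continuous fun x => K (x - y) := by fun_prop
        rw [lintegral_const_mul _ hKy.enorm.measurable]
        congr 1
        exact lintegral_sub_right_eq_self (fun y => ‖K y‖ₑ) y
    _ = _ := by
        rw [lintegral_mul_const'' _ (hg.enorm.pow_const 2)]
        ring

end WeakDeriv

/-! ### Finite differences of `C^s` functions -/

section FiniteDifference

/-- By the mean value inequality one difference turns the bound `C` on the derivative of order `s +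
1` into the bound `C ‖h‖` on the derivative of order `s` of `fwdDiff h f`, to which induction
applies. -/
theorem norm_fwdDiff_iter_le {E : Type*} [NormedAddCommGroup E] [NormedSpace ℝ E] (h : E) (s : ℕ)
    {f : E → ℝ} (hf : ContDiff ℝ s f) {C : ℝ} (hC : ∀ x, ‖iteratedFDeriv ℝ s f x‖ ≤ C) (x : E) :
    ‖(fwdDiff h)^[s] f x‖ ≤ C * ‖h‖ ^ s := by
  induction s generalizing f C x with
  | zero => simpa using hC x
  | succ s ih =>
    have hs : ContDiff ℝ s f := hf.of_le (by exact_mod_cast Nat.le_succ s)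
    have hsh : ContDiff ℝ s (fun y => f (y + h)) := by fun_prop
    have hd : Differentiable ℝ (iteratedFDeriv ℝ s f) :=
      hf.differentiable_iteratedFDeriv (by exact_mod_cast Nat.lt_succ_self s)
    have hb : ∀ y, ‖iteratedFDeriv ℝ s (fwdDiff h f) y‖ ≤ C * ‖h‖ := by
      intro y
      have e : iteratedFDeriv ℝ s (fwdDiff h f) y =
          iteratedFDeriv ℝ s f (y + h) - iteratedFDeriv ℝ s f y := by
        have : fwdDiff h f = (fun y => f (y + h)) - f := rfl
        rw [this, iteratedFDeriv_sub_apply hsh.contDiffAt hs.contDiffAt,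
          iteratedFDeriv_comp_add_right]
      rw [e]
      have := Convex.norm_image_sub_le_of_norm_fderiv_le (𝕜 := ℝ) (f := iteratedFDeriv ℝ s f)
        (C := C) (s := Set.univ) (fun z _ => hd z)
        (fun z _ => by rw [norm_fderiv_iteratedFDeriv]; exact hC z) convex_univ
        (Set.mem_univ y) (Set.mem_univ (y + h))
      simpa using this
    have := ih (hsh.sub hs) hb x
    rw [Function.iterate_succ_apply, pow_succ', ← mul_assoc]
    exact this

/-- Up to the sign `(-1)^s`, the left side is the `s`-th difference with step `-h`; its `k = 0` term
is split off as `f x`. -/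
theorem abs_sub_sum_binomial_le {E : Type*} [NormedAddCommGroup E] [NormedSpace ℝ E] (s : ℕ)
    {f : E → ℝ} (hf : ContDiff ℝ s f) {C : ℝ} (hC : ∀ x, ‖iteratedFDeriv ℝ s f x‖ ≤ C) (x h : E) :
    |f x - ∑ j ∈ Finset.range s, (-1 : ℝ) ^ j * s.choose (j + 1) * f (x - ((j : ℝ) + 1) • h)| ≤
      C * ‖h‖ ^ s := by
  have h1 := norm_fwdDiff_iter_le (-h) s hf hC x
  rw [fwdDiff_iter_eq_sum_shift, norm_neg] at h1
  have h2 : ∑ k ∈ Finset.range (s + 1), ((-1 : ℤ) ^ (s - k) * s.choose k) • f (x + k • (-h)) =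
      (-1) ^ s * (f x - ∑ j ∈ Finset.range s, (-1 : ℝ) ^ j * s.choose (j + 1) *
        f (x - ((j : ℝ) + 1) • h)) := by
    rw [Finset.sum_range_succ', mul_sub, Finset.mul_sum, add_comm, sub_eq_add_neg,
      ← Finset.sum_neg_distrib]
    congr 1
    · simp
    · refine Finset.sum_congr rfl fun j hj => ?_
      have hj' : j + 1 ≤ s := Finset.mem_range.1 hj
      have e1 : x + (j + 1) • (-h) = x - ((j : ℝ) + 1) • h := by
        rw [smul_neg, ← sub_eq_add_neg, ← Nat.cast_smul_eq_nsmul ℝ]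
        push_cast; rfl
      have e2 : (-1 : ℝ) ^ s = (-1) ^ (s - (j + 1)) * ((-1) ^ j * (-1)) := by
        rw [← pow_succ, ← pow_add]; congr 1; omega
      have e3 : (-1 : ℝ) ^ j * (-1) ^ j = 1 := by
        rw [← mul_pow]; simp
      rw [e1, e2, zsmul_eq_mul]
      push_cast
      linear_combination (-(-1 : ℝ) ^ (s - (j + 1)) * s.choose (j + 1) *
        f (x - ((j : ℝ) + 1) • h)) * e3
  rw [h2, norm_mul, norm_pow, norm_neg, norm_one, one_pow, one_mul] at h1
  exact h1

end FiniteDifference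

/-! ### Dilated kernels reproducing `f` up to order `s` -/

section Kernel

variable {d : ℕ} {f K : EuclideanSpace ℝ (Fin d) → ℝ}

/-- The `L¹`-normalised dilation `σ^{-d} K(z / σ)`. -/
def dilate (σ : ℝ) (K : EuclideanSpace ℝ (Fin d) → ℝ) : EuclideanSpace ℝ (Fin d) → ℝ :=
  fun z => σ⁻¹ ^ d * K (σ⁻¹ • z)

theorem ContDiff.dilate (σ : ℝ) (hK : ContDiff ℝ ∞ K) : ContDiff ℝ ∞ (dilate σ K) := by
  unfold _root_.dilate; fun_prop

theorem HasCompactSupport.dilate {σ : ℝ} (hσ : 0 < σ) (hc : HasCompactSupport K) :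
    HasCompactSupport (dilate σ K) :=
  (hc.comp_smul (inv_ne_zero hσ.ne')).mul_left

theorem mixedPartial_dilate (σ : ℝ) (hK : ContDiff ℝ ∞ K) (α : Fin d → ℕ) :
    mixedPartial α (dilate σ K) =
      fun z => σ⁻¹ ^ multiOrder α * dilate σ (mixedPartial α K) z := by
  have := mixedPartial_comp_affine α hK σ⁻¹ (σ⁻¹ ^ d) 0
  simp only [zero_add] at this
  exact this

theorem realConv_dilate {σ : ℝ} (hσ : 0 < σ) (x : EuclideanSpace ℝ (Fin d)) :
    realConv f (dilate σ K) x = ∫ u, f (x - σ • u) * K u := by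
  have h1 : realConv f (dilate σ K) x = ∫ y, f (x - y) * dilate σ K y := by
    rw [realConv_eq_convolution]
    exact convolution_mul_swap
  have h2 := Measure.integral_comp_inv_smul_of_nonneg volume (fun u => f (x - σ • u) * K u) hσ.le
  rw [finrank_euclideanSpace_fin] at h2
  have hd : σ ^ d ≠ 0 := pow_ne_zero _ hσ.ne'
  rw [h1, ← inv_smul_smul₀ hd (∫ u, f (x - σ • u) * K u), ← h2, smul_eq_mul, ← integral_const_mul]
  refine integral_congr_ae (Eventually.of_forall fun y => ?_)
  simp only [dilate, smul_inv_smul₀ hσ.ne', inv_pow]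
  ring

theorem lintegral_enorm_dilate {σ : ℝ} (hσ : 0 < σ) (hK : Continuous K)
    (hc : HasCompactSupport K) : ∫⁻ z, ‖dilate σ K z‖ₑ = ∫⁻ z, ‖K z‖ₑ := by
  have hKi := hK.integrable_of_hasCompactSupport (μ := volume) hc
  have hDi : Integrable (dilate σ K) volume :=
    (hKi.comp_smul (inv_ne_zero hσ.ne')).const_mul _
  rw [← ofReal_integral_norm_eq_lintegral_enorm hKi, ← ofReal_integral_norm_eq_lintegral_enorm hDi]
  congr 1
  have h2 := Measure.integral_comp_inv_smul_of_nonneg volume (fun u => ‖K u‖) hσ.le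
  rw [finrank_euclideanSpace_fin] at h2
  simp only [dilate, norm_mul, integral_const_mul, h2, smul_eq_mul, ← mul_assoc]
  rw [Real.norm_of_nonneg (by positivity), inv_pow, inv_mul_cancel₀ (pow_ne_zero _ hσ.ne'), one_mul]

/-- A combination of dilations of `φ` whose convolution with `f` differs from `f` by averages of
`s`-th differences of `f`. -/
def diffKernel (s : ℕ) (φ : EuclideanSpace ℝ (Fin d) → ℝ) : EuclideanSpace ℝ (Fin d) → ℝ :=
  fun z => ∑ j ∈ Finset.range s, (-1 : ℝ) ^ j * s.choose (j + 1) * dilate ((j : ℝ) + 1) φ z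

theorem contDiff_diffKernel (s : ℕ) (hK : ContDiff ℝ ∞ K) : ContDiff ℝ ∞ (diffKernel s K) :=
  ContDiff.sum fun _ _ => contDiff_const.mul (hK.dilate _)

theorem hasCompactSupport_finsetSum {ι X : Type*} [TopologicalSpace X] (t : Finset ι)
    {u : ι → X → ℝ} (h : ∀ i ∈ t, HasCompactSupport (u i)) :
    HasCompactSupport (fun x => ∑ i ∈ t, u i x) := by
  classical
  induction t using Finset.induction_on with
  | empty =>
    simp only [Finset.sum_empty]
    exact (HasCompactSupport.zero : HasCompactSupport (0 : X → ℝ))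
  | insert a t ha ih =>
    simp only [Finset.sum_insert ha]
    exact (h a (Finset.mem_insert_self a t)).add
      (ih fun i hi => h i (Finset.mem_insert_of_mem hi))

theorem hasCompactSupport_diffKernel (s : ℕ) (hc : HasCompactSupport K) :
    HasCompactSupport (diffKernel s K) :=
  hasCompactSupport_finsetSum _ fun _ _ => (hc.dilate (by positivity)).mul_left

theorem realConv_dilate_diffKernel (s : ℕ) (hf : Continuous f) (hK : Continuous K)
    (hc : HasCompactSupport K) {σ : ℝ} (hσ : 0 < σ) (x : EuclideanSpace ℝ (Fin d)) :
    realConv f (dilate σ (diffKernel s K)) x =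
      ∫ u, (∑ j ∈ Finset.range s, (-1 : ℝ) ^ j * s.choose (j + 1) *
        f (x - ((j : ℝ) + 1) • σ • u)) * K u := by
  have hj : ∀ j : ℕ, (0 : ℝ) < j + 1 := fun j => by positivity
  have hd : ∀ j : ℕ, Continuous (dilate ((j : ℝ) + 1) K) := fun j => by
    unfold dilate; fun_prop
  have key : ∀ j : ℕ, ∫ u, f (x - σ • u) * dilate ((j : ℝ) + 1) K u =
      ∫ u, f (x - ((j : ℝ) + 1) • σ • u) * K u := by
    intro j
    -- The dilation formula is applied at the origin to a reflected translate of `f`, which makes it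
    -- a plain change of variables.
    have := realConv_dilate (f := fun y => f (x - σ • (-y))) (K := K) (hj j) 0
    have h0 : realConv (fun y => f (x - σ • (-y))) (dilate ((j : ℝ) + 1) K) 0 =
        ∫ u, f (x - σ • u) * dilate ((j : ℝ) + 1) K u := by
      rw [realConv_eq_convolution, convolution_mul_swap]
      simp
    rw [← h0, this]
    simp [smul_comm σ]
  rw [realConv_dilate hσ]
  simp only [diffKernel, Finset.mul_sum, Finset.sum_mul]
  rw [integral_finsetSum, integral_finsetSum]
  · refine Finset.sum_congr rfl fun j _ => ?_
    simp only [mul_left_comm (f _), mul_assoc, integral_const_mul, key]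
  · intro j _
    refine Continuous.integrable_of_hasCompactSupport (by fun_prop) hc.mul_left
  · intro j _
    have := hd j
    refine Continuous.integrable_of_hasCompactSupport (by fun_prop)
      (hc.dilate (hj j)).mul_left.mul_left

/-- Since the bump has mass one, `f x` is itself an average, and the difference averages `s`-th
differences with step `σ u`, where `‖u‖ < 1` on the support. -/
theorem abs_sub_realConv_le (s : ℕ) (hf : ContDiff ℝ s f) {C : ℝ}
    (hC : ∀ x, ‖iteratedFDeriv ℝ s f x‖ ≤ C) (φ : ContDiffBump (0 : EuclideanSpace ℝ (Fin d)))
    (hφ : φ.rOut = 1) {σ : ℝ} (hσ : 0 < σ) (x : EuclideanSpace ℝ (Fin d)) :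
    |f x - realConv f (dilate σ (diffKernel s (φ.normed volume))) x| ≤ C * σ ^ s := by
  have hfc : Continuous f := hf.continuous
  have hKc : Continuous (φ.normed volume) := φ.continuous_normed
  have hC0 : 0 ≤ C := (norm_nonneg _).trans (hC 0)
  rw [realConv_dilate_diffKernel s hfc hKc φ.hasCompactSupport_normed hσ]
  have e : f x = ∫ u, f x * φ.normed volume u := by
    rw [integral_const_mul, φ.integral_normed, mul_one]
  nth_rw 1 [e]
  have hint : Integrable (fun u => (∑ j ∈ Finset.range s, (-1 : ℝ) ^ j * s.choose (j + 1) *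
      f (x - ((j : ℝ) + 1) • σ • u)) * φ.normed volume u) volume :=
    Continuous.integrable_of_hasCompactSupport (by fun_prop) φ.hasCompactSupport_normed.mul_left
  rw [← integral_sub (φ.integrable_normed.const_mul _) hint, ← Real.norm_eq_abs]
  have e2 : C * σ ^ s = ∫ u, C * σ ^ s * φ.normed volume u := by
    rw [integral_const_mul, φ.integral_normed, mul_one]
  rw [e2]
  refine norm_integral_le_of_norm_le (φ.integrable_normed.const_mul _)
    (Eventually.of_forall fun u => ?_)
  rw [← sub_mul, norm_mul, Real.norm_of_nonneg (φ.nonneg_normed u)]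
  by_cases hu : u ∈ Function.support (φ.normed volume)
  · refine mul_le_mul_of_nonneg_right ?_ (φ.nonneg_normed u)
    refine (abs_sub_sum_binomial_le s hf hC x (σ • u)).trans ?_
    rw [φ.support_normed_eq, hφ, mem_ball_zero_iff] at hu
    rw [norm_smul, Real.norm_of_nonneg hσ.le]
    gcongr
    exact mul_le_of_le_one_right hσ.le hu.le
  · rw [Function.notMem_support.1 hu, mul_zero, mul_zero]

end Kernel

/-! ### Smooth approximation in the uniform and Sobolev norms -/

section Approximation

variable {d : ℕ} {f : EuclideanSpace ℝ (Fin d) → ℝ}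

theorem exists_smooth_approximation {r s : ℕ} (hs : s ≤ r) (hf : MemC0 s f)
    (hfs : MemSobolev s f) :
    ∃ (C : ℝ) (A : (Fin d → ℕ) → ℝ), ∀ σ : ℝ, 0 < σ → σ ≤ 1 →
      ∃ F : EuclideanSpace ℝ (Fin d) → ℝ, ContDiff ℝ ∞ F ∧ (∀ x, |f x - F x| ≤ C * σ ^ s) ∧
        ∀ α, multiOrder α ≤ r → MemLp (mixedPartial α F) 2 volume ∧
          (eLpNorm (mixedPartial α F) 2 volume).toReal ≤ A α * σ⁻¹ ^ (r - s) := by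
  obtain ⟨C, hC⟩ := hf.2.2 s le_rfl
  let φ : ContDiffBump (0 : EuclideanSpace ℝ (Fin d)) := ⟨1 / 2, 1, by norm_num, by norm_num⟩
  let K := diffKernel s (φ.normed volume)
  have hK : ContDiff ℝ ∞ K := contDiff_diffKernel s φ.contDiff_normed
  have hKc : HasCompactSupport K := hasCompactSupport_diffKernel s φ.hasCompactSupport_normed
  -- `A` is fixed before `σ`, and the order condition sits under the existential so that `choose`
  -- yields a function of all `α`.
  have key : ∀ α : Fin d → ℕ, ∃ A : ℝ, multiOrder α ≤ r → ∀ σ : ℝ, 0 < σ → σ ≤ 1 →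
      MemLp (mixedPartial α (realConv f (dilate σ K))) 2 volume ∧
        (eLpNorm (mixedPartial α (realConv f (dilate σ K))) 2 volume).toReal ≤
          A * σ⁻¹ ^ (r - s) := by
    intro α
    by_cases hα : multiOrder α ≤ r
    · obtain ⟨β, γ, rfl, hβ, hγ⟩ := exists_multiIndex_add s (r - s) α (by omega)
      obtain ⟨g, hg, hg2⟩ := hfs.2 β hβ
      have hγK := hK.mixedPartial γ
      have hγKc := hKc.mixedPartial γ hK
      have hfin : (∫⁻ z, ‖mixedPartial γ K z‖ₑ) * eLpNorm g 2 volume ≠ ⊤ :=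
        ENNReal.mul_ne_top
          (hγK.continuous.integrable_of_hasCompactSupport (μ := volume) hγKc).2.ne hg2.2.ne
      refine ⟨((∫⁻ z, ‖mixedPartial γ K z‖ₑ) * eLpNorm g 2 volume).toReal,
        fun _ σ hσ hσ1 => ?_⟩
      -- Lets `σ⁻¹ ^ |γ|` be enlarged to `σ⁻¹ ^ (r - s)`, as `|γ| ≤ r - s`.
      have hσ' : 1 ≤ σ⁻¹ := (one_le_inv₀ hσ).2 hσ1
      have hD := hK.dilate σ
      have hDc := hKc.dilate hσ
      have hint : ∫⁻ z, ‖mixedPartial γ (dilate σ K) z‖ₑ =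
          ENNReal.ofReal (σ⁻¹ ^ multiOrder γ) * ∫⁻ z, ‖mixedPartial γ K z‖ₑ := by
        rw [mixedPartial_dilate σ hK γ]
        simp only [enorm_mul]
        rw [lintegral_const_mul _ (hγK.dilate σ).continuous.enorm.measurable,
          lintegral_enorm_dilate hσ hγK.continuous hγKc, Real.enorm_of_nonneg (by positivity)]
      have hle : eLpNorm (mixedPartial (β + γ) (realConv f (dilate σ K))) 2 volume ≤
          ENNReal.ofReal (σ⁻¹ ^ (r - s)) *
            ((∫⁻ z, ‖mixedPartial γ K z‖ₑ) * eLpNorm g 2 volume) := by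
        rw [hg.mixedPartial_realConv_add hD hDc γ]
        refine (eLpNorm_two_realConv_le hg2.1 (hD.mixedPartial γ).continuous).trans ?_
        rw [hint, mul_assoc]
        gcongr
      have hne : ENNReal.ofReal (σ⁻¹ ^ (r - s)) *
            ((∫⁻ z, ‖mixedPartial γ K z‖ₑ) * eLpNorm g 2 volume) ≠ ⊤ :=
        ENNReal.mul_ne_top ENNReal.ofReal_ne_top hfin
      refine ⟨⟨((contDiff_realConv hg.1 hD hDc).mixedPartial _).continuous.aestronglyMeasurable,
        hle.trans_lt hne.lt_top⟩, ?_⟩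
      refine (ENNReal.toReal_mono hne hle).trans_eq ?_
      rw [ENNReal.toReal_mul, ENNReal.toReal_ofReal (by positivity), mul_comm]
    · exact ⟨0, fun h => absurd h hα⟩
  choose A hA using key
  refine ⟨C, A, fun σ hσ hσ1 => ⟨realConv f (dilate σ K), ?_, ?_, fun α hα => hA α hα σ hσ hσ1⟩⟩
  · exact contDiff_realConv hf.1.continuous.locallyIntegrable (hK.dilate σ) (hKc.dilate hσ)
  · exact abs_sub_realConv_le s hf.1 hC φ rfl hσ

end Approximation

/-! ### Quadrature error and the balance of scales -/

section Quadrature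

variable {d : ℕ}

/-- The error is homogeneous and `B⁻¹ F` lies in the unit ball, because `B` dominates the Sobolev
norm of `F`. -/
theorem ofReal_abs_error_le_worstCaseError {n r : ℕ} (P : Measure (EuclideanSpace ℝ (Fin d)))
    (w : Fin n → ℝ) (X : Fin n → EuclideanSpace ℝ (Fin d)) {F : EuclideanSpace ℝ (Fin d) → ℝ}
    (hF : ContDiff ℝ ∞ F) {B : ℝ} (hB : 0 < B) (A : (Fin d → ℕ) → ℝ)
    (hA : ∀ α, multiOrder α ≤ r → MemLp (mixedPartial α F) 2 volume ∧
      (eLpNorm (mixedPartial α F) 2 volume).toReal ≤ A α)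
    (hAB : ∑ k ∈ Finset.range (r + 1),
      ∑ α ∈ Finset.piAntidiag (Finset.univ : Finset (Fin d)) k, A α ^ 2 ≤ B ^ 2) :
    ENNReal.ofReal |(∫ x, F x ∂P) - quadrature w X F| ≤
      ENNReal.ofReal B * worstCaseError r P w X := by
  have hweak : ∀ α, IsWeakDeriv α (fun x => B⁻¹ * F x) (fun x => B⁻¹ * mixedPartial α F x) :=
    fun α => (isWeakDeriv_mixedPartial hF α).const_mul _
  have hmem : (fun x => B⁻¹ * F x) ∈ sobolevUnitBall d r := by
    refine ⟨continuous_const.mul hF.continuous, ⟨?_, fun α hα => ⟨_, hweak α, (hA α hα).1.const_mul _⟩⟩,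
      ?_⟩
    · have := (hA 0 (by simp [multiOrder_zero])).1
      rw [mixedPartial_zero] at this
      exact this.const_mul _
    · rw [sobolevNorm, Real.sqrt_le_one]
      have hterm : ∀ k ∈ Finset.range (r + 1),
          ∀ α ∈ Finset.piAntidiag (Finset.univ : Finset (Fin d)) k,
          (eLpNorm (weakDeriv α (fun x => B⁻¹ * F x)) 2 volume).toReal ^ 2 ≤
            (B ^ 2)⁻¹ * A α ^ 2 := by
        intro k hk α hα
        have hαk : multiOrder α = k := (Finset.mem_piAntidiag.1 hα).1
        have hαr : multiOrder α ≤ r := by rw [hαk]; exact Nat.lt_succ_iff.1 (Finset.mem_range.1 hk)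
        rw [eLpNorm_congr_ae (hweak α).weakDeriv_ae_eq]
        have : eLpNorm (fun x => B⁻¹ * mixedPartial α F x) 2 volume =
            ‖B⁻¹‖ₑ * eLpNorm (mixedPartial α F) 2 volume := 
          eLpNorm_const_smul B⁻¹ (mixedPartial α F) 2 volume
        rw [this, ENNReal.toReal_mul, toReal_enorm, Real.norm_of_nonneg (by positivity), mul_pow,
          inv_pow]
        gcongr
        exact (hA α hαr).2
      calc _ ≤ ∑ k ∈ Finset.range (r + 1),
            ∑ α ∈ Finset.piAntidiag (Finset.univ : Finset (Fin d)) k, (B ^ 2)⁻¹ * A α ^ 2 :=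
            Finset.sum_le_sum fun k hk => Finset.sum_le_sum (hterm k hk)
        _ ≤ 1 := by
            simp only [← Finset.mul_sum]
            rw [inv_mul_le_one₀ (by positivity)]
            exact hAB
  have hle : ENNReal.ofReal |(∫ x, B⁻¹ * F x ∂P) - quadrature w X (fun x => B⁻¹ * F x)| ≤
      worstCaseError r P w X := le_iSup₂_of_le _ hmem le_rfl
  have he : (∫ x, B⁻¹ * F x ∂P) - quadrature w X (fun x => B⁻¹ * F x) =
      B⁻¹ * ((∫ x, F x ∂P) - quadrature w X F) := by
    rw [integral_const_mul, mul_sub]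
    simp only [quadrature, Finset.mul_sum, mul_left_comm]
  rw [he, abs_mul, abs_of_pos (inv_pos.2 hB)] at hle
  calc _ = ENNReal.ofReal B * ENNReal.ofReal (B⁻¹ * |(∫ x, F x ∂P) - quadrature w X F|) := by
        rw [← ENNReal.ofReal_mul hB.le, mul_inv_cancel_left₀ hB.ne']
    _ ≤ _ := by gcongr

theorem abs_error_sub_le {n : ℕ} (P : Measure (EuclideanSpace ℝ (Fin d))) [IsProbabilityMeasure P]
    (w : Fin n → ℝ) (X : Fin n → EuclideanSpace ℝ (Fin d))
    {f F : EuclideanSpace ℝ (Fin d) → ℝ} (hf : Continuous f) (hF : Continuous F)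
    (hfb : ∃ M, ∀ x, ‖f x‖ ≤ M) {ε : ℝ} (h : ∀ x, |f x - F x| ≤ ε) :
    |quadrature w X f - ∫ x, f x ∂P| ≤
      |(∫ x, F x ∂P) - quadrature w X F| + (∑ i, |w i| + 1) * ε := by
  obtain ⟨M, hM⟩ := hfb
  have hfi : Integrable f P := .of_bound hf.aestronglyMeasurable M (.of_forall hM)
  have hFi : Integrable F P := by
    refine .of_bound hF.aestronglyMeasurable (M + ε) (.of_forall fun x => ?_)
    calc ‖F x‖ = ‖f x - (f x - F x)‖ := by rw [sub_sub_cancel]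
      _ ≤ ‖f x‖ + ‖f x - F x‖ := norm_sub_le _ _
      _ ≤ M + ε := add_le_add (hM x) (h x)
  have h1 : |(∫ x, f x ∂P) - ∫ x, F x ∂P| ≤ ε := by
    rw [← integral_sub hfi hFi, ← Real.norm_eq_abs]
    refine (norm_integral_le_of_norm_le_const (.of_forall h)).trans_eq ?_
    simp
  have h2 : |quadrature w X f - quadrature w X F| ≤ (∑ i, |w i|) * ε := by
    rw [quadrature, quadrature, ← Finset.sum_sub_distrib, Finset.sum_mul]
    refine (Finset.abs_sum_le_sum_abs _ _).trans (Finset.sum_le_sum fun i _ => ?_)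
    rw [← mul_sub, abs_mul]
    exact mul_le_mul_of_nonneg_left (h _) (abs_nonneg _)
  rw [abs_sub_le_iff] at h1 h2
  have h3 := neg_abs_le ((∫ x, F x ∂P) - quadrature w X F)
  have h4 := le_abs_self ((∫ x, F x ∂P) - quadrature w X F)
  rw [abs_sub_le_iff]
  constructor <;> linarith [h1.1, h1.2, h2.1, h2.2]

theorem sum_abs_le_sqrt_mul_rpow {n : ℕ} (w : Fin n → ℝ) {D c : ℝ} (hD : 0 ≤ D)
    (h : ∑ i, w i ^ 2 ≤ D * (n : ℝ) ^ (-2 * c)) (hn : 0 < n) :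
    ∑ i, |w i| ≤ √D * (n : ℝ) ^ (1 / 2 - c) := by
  have hn' : (0 : ℝ) < n := by exact_mod_cast hn
  have h1 : (∑ i, |w i|) ^ 2 ≤ n * ∑ i, w i ^ 2 := by
    have := sq_sum_le_card_mul_sum_sq (s := (Finset.univ : Finset (Fin n))) (f := fun i => |w i|)
    simpa using this
  refine (sq_le_sq₀ (Finset.sum_nonneg fun _ _ => abs_nonneg _) (by positivity)).1 ?_
  rw [mul_pow, Real.sq_sqrt hD, ← Real.rpow_natCast, ← Real.rpow_natCast, ← Real.rpow_mul hn'.le]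
  rw [← Real.rpow_natCast] at h1
  refine h1.trans ((mul_le_mul_of_nonneg_left h hn'.le).trans_eq ?_)
  have e : (n : ℝ) ^ ((1 / 2 - c) * ((2 : ℕ) : ℝ)) = n * (n : ℝ) ^ (-2 * c) := by
    nth_rw 2 [← Real.rpow_one (n : ℝ)]
    rw [← Real.rpow_add hn']
    congr 1; push_cast; ring
  rw [e]; ring

theorem isBigO_abs_error {r : ℕ} (hr : 0 < r)
    (P : Measure (EuclideanSpace ℝ (Fin d))) [IsProbabilityMeasure P]
    (w : (n : ℕ) → Fin n → ℝ) (X : (n : ℕ) → Fin n → EuclideanSpace ℝ (Fin d)) {b c : ℝ}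
    (hb : 0 < b) (hc : c ≤ 1 / 2)
    (he : HasRate (fun n => worstCaseError r P (w n) (X n)) b)
    (hw : (fun n : ℕ => ∑ i, (w n i) ^ 2) =O[atTop] (fun n : ℕ => (n : ℝ) ^ (-2 * c)))
    {s : ℕ} (hs : s ≤ r) {f : EuclideanSpace ℝ (Fin d) → ℝ} (hf : MemC0 s f)
    (hfs : MemSobolev s f) :
    (fun n : ℕ => |quadrature (w n) (X n) f - ∫ x, f x ∂P|) =O[atTop]
      (fun n : ℕ => (n : ℝ) ^ (-(b * s / r) + (1 / 2 - c) * (1 - (s : ℝ) / r))) := by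
  obtain ⟨C, A, hCA⟩ := exists_smooth_approximation hs hf hfs
  obtain ⟨E, hE⟩ := he
  obtain ⟨D, hD0, hD⟩ := hw.exists_nonneg
  have hC : 0 ≤ C := by
    obtain ⟨F, -, h, -⟩ := hCA 1 one_pos le_rfl
    simpa using (abs_nonneg _).trans (h 0)
  obtain ⟨M, hM⟩ := hf.2.2 0 (Nat.zero_le _)
  have hfb : ∃ M, ∀ x, ‖f x‖ ≤ M := ⟨M, fun x => by simpa using hM x⟩
  have hr' : (0 : ℝ) < r := by exact_mod_cast hr
  set S := ∑ k ∈ Finset.range (r + 1),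
    ∑ α ∈ Finset.piAntidiag (Finset.univ : Finset (Fin d)) k, A α ^ 2 with hS
  have hS0 : 0 ≤ S := Finset.sum_nonneg fun _ _ => Finset.sum_nonneg fun _ _ => sq_nonneg _
  -- Solves `(r - s) θ - b = (1/2 - c) - s θ`, which equates the two error terms for every `s`.
  set θ := (b + (1 / 2 - c)) / r with hθ
  have hθ0 : 0 ≤ θ := div_nonneg (by linarith) hr'.le
  refine Asymptotics.IsBigO.of_bound ((√S + 1) * |E| + (√D + 1) * C) ?_
  filter_upwards [hE, hD.bound, eventually_gt_atTop 0] with n hEn hDn hn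
  have hn' : (0 : ℝ) < n := by exact_mod_cast hn
  have hn1 : (1 : ℝ) ≤ n := by exact_mod_cast hn
  set σ := (n : ℝ) ^ (-θ) with hσd
  have hσ : 0 < σ := Real.rpow_pos_of_pos hn' _
  have hσ1 : σ ≤ 1 := Real.rpow_le_one_of_one_le_of_nonpos hn1 (by linarith)
  obtain ⟨F, hF, hfF, hFA⟩ := hCA σ hσ hσ1
  have hτ : 0 < σ⁻¹ ^ (r - s) := pow_pos (inv_pos.2 hσ) _
  -- The extra `1` keeps the normalising constant positive even when `S = 0`.
  have hB : 0 < (√S + 1) * σ⁻¹ ^ (r - s) := by positivity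
  have h1 := ofReal_abs_error_le_worstCaseError P (w n) (X n) hF hB
    (fun α => A α * σ⁻¹ ^ (r - s)) hFA (by
      simp only [mul_pow _ (σ⁻¹ ^ (r - s)), ← Finset.sum_mul, ← hS]
      gcongr
      nlinarith [Real.sq_sqrt hS0, Real.sqrt_nonneg S])
  have h2 : |(∫ x, F x ∂P) - quadrature (w n) (X n) F| ≤
      (√S + 1) * σ⁻¹ ^ (r - s) * (|E| * (n : ℝ) ^ (-b)) := by
    rw [← ENNReal.ofReal_le_ofReal_iff (by positivity), ENNReal.ofReal_mul hB.le]
    refine h1.trans (mul_le_mul_right (hEn.trans (ENNReal.ofReal_le_ofReal ?_)) _)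
    gcongr
    exact le_abs_self E
  have h3 := abs_error_sub_le P (w n) (X n) hf.1.continuous hF.continuous hfb hfF
  have hDn' : ∑ i, w n i ^ 2 ≤ D * (n : ℝ) ^ (-2 * c) := by
    rwa [Real.norm_of_nonneg (Finset.sum_nonneg fun _ _ => sq_nonneg _),
      Real.norm_of_nonneg (by positivity)] at hDn
  have h4 := sum_abs_le_sqrt_mul_rpow (w n) hD0 hDn' hn
  -- As `c ≤ 1/2`, the contribution of `P` itself is absorbed into that of the weights.
  have h5 : (1 : ℝ) ≤ (n : ℝ) ^ (1 / 2 - c) := Real.one_le_rpow hn1 (by linarith)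
  have h6 : ∑ i, |w n i| + 1 ≤ (√D + 1) * (n : ℝ) ^ (1 / 2 - c) := by linarith
  set p := -(b * s / r) + (1 / 2 - c) * (1 - (s : ℝ) / r) with hp
  have e1 : σ⁻¹ ^ (r - s) * (n : ℝ) ^ (-b) = (n : ℝ) ^ p := by
    rw [hσd, ← Real.rpow_neg hn'.le, neg_neg, ← Real.rpow_natCast, ← Real.rpow_mul hn'.le,
      ← Real.rpow_add hn', Nat.cast_sub hs]
    congr 1
    rw [hp, hθ]; field_simp; ring
  have e2 : (n : ℝ) ^ (1 / 2 - c) * σ ^ s = (n : ℝ) ^ p := by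
    rw [hσd, ← Real.rpow_natCast, ← Real.rpow_mul hn'.le, ← Real.rpow_add hn']
    congr 1
    rw [hp, hθ]; field_simp; ring
  rw [Real.norm_of_nonneg (abs_nonneg _), Real.norm_of_nonneg (by positivity)]
  calc _ ≤ _ := h3
    _ ≤ (√S + 1) * σ⁻¹ ^ (r - s) * (|E| * (n : ℝ) ^ (-b)) +
        (√D + 1) * (n : ℝ) ^ (1 / 2 - c) * (C * σ ^ s) := by gcongr
    _ = (√S + 1) * |E| * (σ⁻¹ ^ (r - s) * (n : ℝ) ^ (-b)) +
        (√D + 1) * C * ((n : ℝ) ^ (1 / 2 - c) * σ ^ s) := by ring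
    _ = _ := by rw [e1, e2]; ring

end Quadrature

end

theorem theorem2 (d r : ℕ) (hd : 0 < d) (hr : (d : ℝ) / 2 < r)
    (P : Measure (EuclideanSpace ℝ (Fin d))) [IsProbabilityMeasure P]
    (w : (n : ℕ) → Fin n → ℝ) (X : (n : ℕ) → Fin n → EuclideanSpace ℝ (Fin d)) :
    (∀ b c : ℝ, 0 < b → 0 < c → c ≤ 1 / 2 →
      HasRate (fun n => worstCaseError r P (w n) (X n)) b →
      (fun n : ℕ => ∑ i, (w n i) ^ 2) =O[atTop] (fun n : ℕ => (n : ℝ) ^ (-2 * c)) →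
      ∀ s : ℕ, s ≤ r → ∀ f : EuclideanSpace ℝ (Fin d) → ℝ, MemC0 s f → MemSobolev s f →
        (fun n : ℕ => |quadrature (w n) (X n) f - ∫ x, f x ∂P|) =O[atTop]
          (fun n : ℕ => (n : ℝ) ^ (-(b * s / r) + (1 / 2 - c) * (1 - (s : ℝ) / r)))) ∧
    (HasRate (fun n => worstCaseError r P (w n) (X n)) ((r : ℝ) / d) →
      (fun n : ℕ => ∑ i, (w n i) ^ 2) =O[atTop] (fun n : ℕ => (n : ℝ) ^ (-1 : ℝ)) →
      ∀ s : ℕ, s ≤ r → ∀ f : EuclideanSpace ℝ (Fin d) → ℝ, MemC0 s f → MemSobolev s f →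
        (fun n : ℕ => |quadrature (w n) (X n) f - ∫ x, f x ∂P|) =O[atTop]
          (fun n : ℕ => (n : ℝ) ^ (-((s : ℝ) / d)))) := by

  have hd' : (0 : ℝ) < d := by exact_mod_cast hd
  have hr' : (0 : ℝ) < r := lt_of_le_of_lt (by positivity) hr
  have hr0 : 0 < r := by exact_mod_cast hr'
  refine ⟨fun b c hb _ hc he hw s hs f hf hfs => isBigO_abs_error hr0 P w X hb hc he hw hs hf hfs,
    fun he hw s hs f hf hfs => ?_⟩
  -- With `c = 1/2` the weights cost nothing, and `b = r/d` turns `b s / r` into `s/d`.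
  have h := isBigO_abs_error hr0 P w X (c := 1 / 2) (by positivity) le_rfl he
    (by simpa using hw) hs hf hfs
  have e : -((r : ℝ) / d * s / r) + (1 / 2 - 1 / 2) * (1 - (s : ℝ) / r) = -((s : ℝ) / d) := by
    field_simp
    ring
  rwa [e] at h
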